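/- Let $H,K$ be (real or complex) Hilbert spaces and let $T:D(T)\subset H\to K$ be a densely defined closed operator whose range $R(T)$ is closed. For a closed operator $S$ let $S^\dagger$ be its Moore–Penrose inverse, with domain $R(S)\oplus R(S)^\perp$, which is $\bigl(S|_{D(S)\cap N(S)^\perp}\bigr)^{-1}$ on $R(S)$ and $0$ on $R(S)^\perp$. Products of operators are taken on their natural domains. Let $w(T)=T(T^*T)^\dagger$ be the generalized Cauchy dual of $T$. A polar decomposition of a densely defined operator $S$ is a factorization $S=U|S|$ (with $D(S)=D(|S|)$), where $|S|=(S^*S)^{1/2}$ is a nonnegative self-adjoint operator with square $S^*S$, and $U$ is a bounded everywhere defined partial isometry with initial space $\overline{R(|S|)}$ and final space $\overline{R(S)}$. Then $T$ has a unique polar decomposition $T=U_T|T|$, the operator $w(T)|T|$ is closable, and $$U_T=\overline{w(T)\,|T|}.$$ Moreover, $w(T)$ has a unique polar decomposition, and it is $w(T)=U_T\,|w(T)|$; that is, $U_{w(T)}=U_T$. -/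

import Mathlib

noncomputable section

namespace LinearPMap

section Algebra

variable {R E F G : Type*} [Ring R] [AddCommGroup E] [Module R E] [AddCommGroup F] [Module R F]
  [AddCommGroup G] [Module R G]

/-- The null space `N(T) = {x ∈ D(T) | T x = 0}`, as a subspace of the ambient space. -/
def nullSpace (T : E →ₗ.[R] F) : Submodule R E :=
  (LinearMap.ker T.toFun).map T.domain.subtype

/-- The range `R(T) = {T x | x ∈ D(T)}`. -/
def rangeSpace (T : E →ₗ.[R] F) : Submodule R F :=
  LinearMap.range T.toFun

theorem mem_nullSpace_iff (T : E →ₗ.[R] F) (x : E) :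
    x ∈ T.nullSpace ↔ ∃ h : x ∈ T.domain, T ⟨x, h⟩ = 0 := by
  constructor
  · rintro ⟨y, hy, rfl⟩
    exact ⟨y.2, hy⟩
  · rintro ⟨h, hx⟩
    exact ⟨⟨x, h⟩, hx, rfl⟩

theorem exists_domain_of_mem_map (S : F →ₗ.[R] G) (T : E →ₗ.[R] F) (x : E)
    (hx : x ∈ (S.domain.comap T.toFun).map T.domain.subtype) :
    ∃ h : x ∈ T.domain, T ⟨x, h⟩ ∈ S.domain := by
  obtain ⟨y, hy, rfl⟩ := hx
  exact ⟨y.2, hy⟩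

/-- The product `S T` of partially defined operators on its natural domain
`D(S T) = {x ∈ D(T) | T x ∈ D(S)}`. -/
def product (S : F →ₗ.[R] G) (T : E →ₗ.[R] F) : E →ₗ.[R] G :=
  S.comp (T.domRestrict ((S.domain.comap T.toFun).map T.domain.subtype)) (by
    rintro ⟨x, hx, hxT⟩
    obtain ⟨h, h'⟩ := exists_domain_of_mem_map S T x hx
    have e : T.domRestrict ((S.domain.comap T.toFun).map T.domain.subtype) ⟨x, hx, hxT⟩
        = T ⟨x, h⟩ := domRestrict_apply rfl
    rw [e]
    exact h')

end Algebra

section Hilbert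

variable {𝕜 H K : Type*} [RCLike 𝕜] [NormedAddCommGroup H] [InnerProductSpace 𝕜 H]
  [NormedAddCommGroup K] [InnerProductSpace 𝕜 K]

/-- The restriction of `T` to its carrier `C(T) = D(T) ∩ N(T)ᗮ`. -/
def carrierRestrict (T : H →ₗ.[𝕜] K) : H →ₗ.[𝕜] K :=
  T.domRestrict T.nullSpaceᗮ

theorem ker_carrierRestrict (T : H →ₗ.[𝕜] K) : LinearMap.ker T.carrierRestrict.toFun = ⊥ := by
  rw [LinearMap.ker_eq_bot']
  rintro ⟨x, hx, hxT⟩ h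
  have e : T.carrierRestrict ⟨x, hx, hxT⟩ = T ⟨x, hxT⟩ := domRestrict_apply rfl
  have h0 : T ⟨x, hxT⟩ = 0 := e.symm.trans h
  have hN : x ∈ T.nullSpace := (mem_nullSpace_iff T x).2 ⟨hxT, h0⟩
  have : x = 0 := inner_self_eq_zero.1 ((Submodule.mem_orthogonal _ _).1 hx x hN)
  exact Subtype.ext this

/-- The Moore-Penrose inverse of `T`: it is the inverse of the restriction of `T` to its carrier
on `R(T)`, it is `0` on `R(T)ᗮ`, and its domain is `R(T) ⊕ R(T)ᗮ`.
(If `T` is closed, then `T` maps its carrier onto `R(T)`.) -/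
def moorePenrose (T : H →ₗ.[𝕜] K) : K →ₗ.[𝕜] H :=
  T.carrierRestrict.inverse.sup ((0 : K →ₗ[𝕜] H).toPMap T.rangeSpaceᗮ) (by
    rintro ⟨x, hx⟩ ⟨y, hy⟩ hxy
    have hxy' : x = y := hxy
    subst hxy'
    have hx' := hx
    rw [inverse_domain] at hx'
    obtain ⟨⟨u, hu, huT⟩, hux⟩ := hx'
    have e : T.carrierRestrict ⟨u, hu, huT⟩ = T ⟨u, huT⟩ := domRestrict_apply rfl
    have hr : x ∈ T.rangeSpace := ⟨⟨u, huT⟩, e.symm.trans hux⟩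
    have h0 : x = 0 := inner_self_eq_zero.1 ((Submodule.mem_orthogonal _ _).1 hy x hr)
    subst h0
    have : (⟨0, hx⟩ : T.carrierRestrict.inverse.domain) = 0 := rfl
    rw [this, map_zero]
    simp)

variable [CompleteSpace H]

/-- The generalized Cauchy dual `w(T) = T (T* T)†`, where `†` is the Moore-Penrose inverse. -/
def cauchyDual (T : H →ₗ.[𝕜] K) : H →ₗ.[𝕜] K :=
  T.product (T.adjoint.product T).moorePenrose

/-- `A` is a modulus `|T| = (T* T)^(1/2)` of `T`: a nonnegative self-adjoint operator whose square
is `T* T`, with equality of domains. -/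
structure IsModulus (T : H →ₗ.[𝕜] K) (A : H →ₗ.[𝕜] H) : Prop where
  isSelfAdjoint : IsSelfAdjoint A
  nonneg : ∀ x : A.domain, 0 ≤ RCLike.re (inner 𝕜 (A x) (x : H))
  sq_eq : A.product A = T.adjoint.product T

open Classical in
/-- The modulus `|T| = (T* T)^(1/2)` (with the value `0` if there is none). -/
def modulus (T : H →ₗ.[𝕜] K) : H →ₗ.[𝕜] H :=
  if h : ∃ A : H →ₗ.[𝕜] H, T.IsModulus A then h.choose else 0

/-- `T = U A` is a polar decomposition of `T`: `A = |T|`, and `U` is a partial isometry with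
initial space the closure of `R(|T|)` and final space the closure of `R(T)`. The initial space
of `U` is `N(U)ᗮ`, and `U` is isometric on it; the final space of `U` is its range. -/
structure IsPolarDecomposition (T : H →ₗ.[𝕜] K) (U : H →L[𝕜] K) (A : H →ₗ.[𝕜] H) : Prop where
  isModulus : T.IsModulus A
  isometric : ∀ x ∈ (LinearMap.ker (U : H →ₗ[𝕜] K))ᗮ, ‖U x‖ = ‖x‖
  initial : (LinearMap.ker (U : H →ₗ[𝕜] K))ᗮ = A.rangeSpace.topologicalClosure
  final : LinearMap.range (U : H →ₗ[𝕜] K) = T.rangeSpace.topologicalClosure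
  eq_comp : T = (U : H →ₗ[𝕜] K).compPMap A

open Classical in
/-- The partial isometry `U_T` of the polar decomposition `T = U_T |T|`
(with the value `0` if there is none). -/
def polarIsometry (T : H →ₗ.[𝕜] K) : H →L[𝕜] K :=
  if h : ∃ U : H →L[𝕜] K, T.IsPolarDecomposition U T.modulus then h.choose else 0

end Hilbert

end LinearPMap

end

/-! Everything is transported to a bounded operator. Put B = T†. Since R(T) is closed, B is
everywhere defined and, by the closed graph theorem, bounded; moreover T = B†
(`exists_eq_generalizedInverse`). For bounded B the graph of B† is explicit, {(x, y) | B*(x - B y) =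
0, y ⊥ N(B)}, so identities between unbounded operators become algebra on graphs: (B†)* = (B*)†, T*T
= (B B*)†, (T*T)† = B B*, and hence w(T) = B† B B* = B*, a bounded operator.

Let Q be the positive square root of B B* and B* = U Q the bounded polar decomposition. Then |w(T)|
= Q and |T| = Q†, and T = B† = U Q† with the same U. Finally w(T)|T| = B* Q† = U Q Q† is the
restriction of U to the dense domain of Q†, so its closure is U.

Uniqueness reduces to that of the positive square root of B B*: a competing modulus of w(T) is a
bounded positive operator, and a competing modulus of T is the Moore-Penrose inverse of one. The
modulus then determines the partial isometry. -/

noncomputable section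

open Filter Topology

/-! ### Convergence of the square root iteration. -/

section SqrtIteration

variable {𝕜 A : Type*} [RCLike 𝕜] [NormedRing A] [NormedAlgebra 𝕜 A]

/-- The iteration `y ↦ (x + y²) / 2` started at `0`. Its limit `y` satisfies
`(1 - y)² = 1 - x`. -/
def sqrtIterate (𝕜 : Type*) {A : Type*} [RCLike 𝕜] [NormedRing A] [NormedAlgebra 𝕜 A] (x : A) :
    ℕ → A
  | 0 => 0
  | n + 1 => (2⁻¹ : 𝕜) • (x + sqrtIterate 𝕜 x n * sqrtIterate 𝕜 x n)

theorem Commute.sqrtIterate_right {x z : A} (h : Commute z x) (n : ℕ) :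
    Commute z (sqrtIterate 𝕜 x n) := by
  induction n with
  | zero => exact Commute.zero_right z
  | succ n ih => exact (h.add_right (ih.mul_right ih)).smul_right _

theorem sqrtIterate_one_mem_Icc (n : ℕ) : sqrtIterate ℝ (1 : ℝ) n ∈ Set.Icc (0 : ℝ) 1 := by
  induction n with
  | zero => simp [sqrtIterate]
  | succ n ih =>
    obtain ⟨h0, h1⟩ := ih
    simp only [sqrtIterate, smul_eq_mul, Set.mem_Icc]
    constructor <;> nlinarith

/-- The scalar iteration at 1 majorizes the iteration at any x in the unit ball; it is the
comparison sequence for all estimates below. -/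
theorem norm_sqrtIterate_le {x : A} (hx : ‖x‖ ≤ 1) (n : ℕ) :
    ‖sqrtIterate 𝕜 x n‖ ≤ sqrtIterate ℝ (1 : ℝ) n := by
  induction n with
  | zero => simp [sqrtIterate]
  | succ n ih =>
    simp only [sqrtIterate, smul_eq_mul, norm_smul, norm_inv, RCLike.norm_ofNat]
    have h1 := norm_add_le x (sqrtIterate 𝕜 x n * sqrtIterate 𝕜 x n)
    have h2 := norm_mul_le (sqrtIterate 𝕜 x n) (sqrtIterate 𝕜 x n)
    have h3 := mul_self_le_mul_self (norm_nonneg _) ih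
    linarith

/-- Iterates commute, so a² - b² = (a + b)(a - b), and the scalar increments factor in the same way.
-/
theorem sqrtIterate_sub_le {x : A} (hx : ‖x‖ ≤ 1) (n : ℕ) :
    ‖sqrtIterate 𝕜 x (n + 1) - sqrtIterate 𝕜 x n‖ ≤
      sqrtIterate ℝ (1 : ℝ) (n + 1) - sqrtIterate ℝ (1 : ℝ) n := by
  induction n with
  | zero =>
    simp only [sqrtIterate, smul_eq_mul, norm_smul, norm_inv, RCLike.norm_ofNat, mul_zero,
      add_zero, sub_zero]
    linarith
  | succ n ih =>
    set a := sqrtIterate 𝕜 x (n + 1) with ha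
    set b := sqrtIterate 𝕜 x n with hb
    have hab : Commute a b :=
      ((Commute.refl x).sqrtIterate_right (𝕜 := 𝕜) (n + 1)).symm.sqrtIterate_right n
    have e : sqrtIterate 𝕜 x (n + 1 + 1) - a = (2⁻¹ : 𝕜) • ((a + b) * (a - b)) := by
      change (2⁻¹ : 𝕜) • (x + a * a) - (2⁻¹ : 𝕜) • (x + b * b) = _
      rw [← hab.mul_self_sub_mul_self_eq, ← smul_sub, add_sub_add_left_eq_sub]
    have e' : sqrtIterate ℝ (1 : ℝ) (n + 1 + 1) - sqrtIterate ℝ (1 : ℝ) (n + 1) =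
        2⁻¹ * ((sqrtIterate ℝ (1 : ℝ) (n + 1) + sqrtIterate ℝ (1 : ℝ) n) *
          (sqrtIterate ℝ (1 : ℝ) (n + 1) - sqrtIterate ℝ (1 : ℝ) n)) := by
      simp only [sqrtIterate, smul_eq_mul]
      ring
    rw [e, e', norm_smul, norm_inv, RCLike.norm_ofNat]
    have h1 : ‖a + b‖ ≤ sqrtIterate ℝ (1 : ℝ) (n + 1) + sqrtIterate ℝ (1 : ℝ) n :=
      (norm_add_le _ _).trans (add_le_add (norm_sqrtIterate_le hx _) (norm_sqrtIterate_le hx _))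
    have h2 := (norm_mul_le (a + b) (a - b)).trans
      (mul_le_mul h1 ih (norm_nonneg _) ((norm_nonneg _).trans h1))
    linarith

theorem cauchySeq_sqrtIterate {x : A} (hx : ‖x‖ ≤ 1) : CauchySeq (sqrtIterate 𝕜 x) := by
  refine cauchySeq_of_dist_le_of_summable
    (fun n => sqrtIterate ℝ (1 : ℝ) (n + 1) - sqrtIterate ℝ (1 : ℝ) n) (fun n => ?_) ?_
  · rw [dist_comm, dist_eq_norm]
    exact sqrtIterate_sub_le hx n
  -- The scalar increments telescope, and the scalar iterates stay below 1.
  · refine summable_of_sum_range_le (c := 1) (fun n => ?_) (fun n => ?_)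
    · exact (norm_nonneg _).trans (sqrtIterate_sub_le (𝕜 := 𝕜) hx n)
    · rw [Finset.sum_range_sub]
      have := (sqrtIterate_one_mem_Icc n).2
      simpa [sqrtIterate] using this

end SqrtIteration

/-! ### Positive square roots of bounded operators. -/

namespace ContinuousLinearMap

variable {𝕜 H K : Type*} [RCLike 𝕜] [NormedAddCommGroup H] [InnerProductSpace 𝕜 H]
  [CompleteSpace H] [NormedAddCommGroup K] [InnerProductSpace 𝕜 K] [CompleteSpace K]

/-- An operator `1 - X` with `X` a self-adjoint contraction has a positive square root. -/
theorem exists_isPositive_mul_self_eq_one_sub {X : H →L[𝕜] H} (hX : IsSelfAdjoint X)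
    (hX1 : ‖X‖ ≤ 1) : ∃ Q : H →L[𝕜] H, Q.IsPositive ∧ Q * Q = 1 - X ∧
      ∀ Z, Commute Z X → Commute Z Q := by
  obtain ⟨Y, hY⟩ := cauchySeq_tendsto_of_complete (cauchySeq_sqrtIterate (𝕜 := 𝕜) hX1)
  have hself : ∀ n, IsSelfAdjoint (sqrtIterate 𝕜 X n) := by
    intro n
    induction n with
    | zero => exact IsSelfAdjoint.zero _
    | succ n ih =>
      refine IsSelfAdjoint.smul (by simp [isSelfAdjoint_iff]) (hX.add ?_)
      simpa only [ih.star_eq] using IsSelfAdjoint.star_mul_self (sqrtIterate 𝕜 X n)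
  have hYself : IsSelfAdjoint Y := by
    refine tendsto_nhds_unique hY.star ?_
    simpa only [(hself _).star_eq] using hY
  have hYnorm : ‖Y‖ ≤ 1 := le_of_tendsto' hY.norm fun n =>
    (norm_sqrtIterate_le hX1 n).trans (sqrtIterate_one_mem_Icc n).2
  have hYeq : Y = (2⁻¹ : 𝕜) • (X + Y * Y) := by
    refine tendsto_nhds_unique ((tendsto_add_atTop_iff_nat 1).2 hY) ?_
    simp only [sqrtIterate]
    exact ((hY.mul hY).const_add X).const_smul _
  -- The fixed point equation 2Y = X + Y² says (1 - Y)² = 1 - X; positivity of 1 - Y follows from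
  -- ‖Y‖ ≤ 1.
  refine ⟨1 - Y, ?_, ?_, fun Z hZ => ?_⟩
  · refine isPositive_def'.2 ⟨(IsSelfAdjoint.one _).sub hYself, fun x => ?_⟩
    rw [reApplyInnerSelf_apply, sub_apply, one_apply_eq_self, inner_sub_left, map_sub,
      inner_self_eq_norm_sq]
    have h1 := re_inner_le_norm (𝕜 := 𝕜) (Y x) x
    have h2 : ‖Y x‖ ≤ 1 * ‖x‖ := Y.le_of_opNorm_le hYnorm x
    nlinarith [norm_nonneg x]
  · have h2 : Y + Y = X + Y * Y := by
      nth_rewrite 1 2 [hYeq]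
      rw [← add_smul, show (2⁻¹ + 2⁻¹ : 𝕜) = 1 by norm_num, one_smul]
    rw [mul_sub, sub_mul, sub_mul, one_mul, one_mul, mul_one,
      show (1 : H →L[𝕜] H) - Y - (Y - Y * Y) = 1 - (Y + Y - Y * Y) by abel, h2,
      add_sub_cancel_right]
  · have : Commute Z Y := tendsto_nhds_unique (hY.const_mul Z)
      (by simpa only [(hZ.sqrtIterate_right (𝕜 := 𝕜) _).eq] using hY.mul_const Z)
    exact (Commute.one_right Z).sub_right this

/-- `W* W` has a positive square root, which commutes with all operators commuting with `W* W`. -/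
theorem exists_isPositive_mul_self_eq (W : H →L[𝕜] K) :
    ∃ Q : H →L[𝕜] H, Q.IsPositive ∧ Q * Q = W.adjoint ∘L W ∧
      ∀ Z, Commute Z (W.adjoint ∘L W) → Commute Z Q := by
  set P : H →L[𝕜] H := W.adjoint ∘L W with hP
  -- Rescaling by r² makes 1 - P / r² a contraction; the summand 1 keeps r nonzero when W = 0.
  set r : ℝ := ‖W‖ + 1 with hr
  have hr0 : 0 < r := by positivity
  have hrk : (r : 𝕜) ≠ 0 := by exact_mod_cast hr0.ne'
  set c : 𝕜 := ((r : 𝕜) ^ 2)⁻¹ with hc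
  have hcr : c = ((((r : ℝ) ^ 2)⁻¹ : ℝ) : 𝕜) := by rw [hc]; push_cast; rfl
  have hcself : IsSelfAdjoint c := by rw [hcr, isSelfAdjoint_iff]; simp
  have hPself : IsSelfAdjoint P := (isPositive_adjoint_comp_self W).isSelfAdjoint
  have hbound : ‖1 - c • P‖ ≤ 1 := by
    refine opNorm_le_bound _ zero_le_one fun x => ?_
    have h1 : ‖W x‖ ≤ ‖W‖ * ‖x‖ := W.le_opNorm x
    have h2 : ‖P x‖ ≤ r * ‖W x‖ := by
      refine (W.adjoint.le_opNorm (W x)).trans ?_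
      rw [LinearIsometryEquiv.norm_map]
      gcongr
      linarith
    have h3 : RCLike.re (inner 𝕜 x (P x)) = ‖W x‖ ^ 2 := by
      rw [hP, coe_comp, Function.comp_apply, adjoint_inner_right, inner_self_eq_norm_sq]
    have h4 : ‖(1 - c • P) x‖ ^ 2 = ‖x‖ ^ 2 - 2 * ((r ^ 2)⁻¹ * ‖W x‖ ^ 2)
        + ((r ^ 2)⁻¹ * ‖P x‖) ^ 2 := by
      rw [sub_apply, one_apply_eq_self, smul_apply, @norm_sub_sq 𝕜, inner_smul_right, hcr,
        RCLike.re_ofReal_mul, h3, norm_smul, RCLike.norm_ofReal, abs_of_pos (by positivity)]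
    have h5 : ((r ^ 2)⁻¹ * ‖P x‖) ^ 2 ≤ (r ^ 2)⁻¹ * ‖W x‖ ^ 2 := by
      calc ((r ^ 2)⁻¹ * ‖P x‖) ^ 2 ≤ ((r ^ 2)⁻¹ * (r * ‖W x‖)) ^ 2 := by gcongr
        _ = (r ^ 2)⁻¹ * ‖W x‖ ^ 2 := by field_simp
    have h6 : 0 ≤ (r ^ 2)⁻¹ * ‖W x‖ ^ 2 := by positivity
    rw [one_mul]
    exact le_of_sq_le_sq (by linarith) (norm_nonneg x)
  obtain ⟨Q, hQ, hQQ, hcomm⟩ := exists_isPositive_mul_self_eq_one_sub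
    ((IsSelfAdjoint.one _).sub (hcself.smul hPself)) hbound
  refine ⟨(r : 𝕜) • Q, hQ.smul_of_nonneg (by exact_mod_cast hr0.le), ?_, fun Z hZ => ?_⟩
  · rw [smul_mul_smul_comm, hQQ, sub_sub_cancel, smul_smul, hc, ← sq,
      mul_inv_cancel₀ (by positivity),
      one_smul]
  · exact (hcomm Z ((Commute.one_right Z).sub_right (hZ.smul_right c))).smul_right _

open scoped ComplexOrder in
/-- Commuting positive operators with the same square agree. -/
theorem IsPositive.eq_of_mul_self_eq {Q G : H →L[𝕜] H} (hQ : Q.IsPositive) (hG : G.IsPositive)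
    (hcomm : Commute G Q) (h : Q * Q = G * G) : Q = G := by
  have hD : IsSelfAdjoint (Q - G) := hQ.isSelfAdjoint.sub hG.isSelfAdjoint
  set D := Q - G with hDdef
  -- D S D and D R D are positive with sum zero, so the quadratic form of D S D vanishes.
  have key : ∀ S R : H →L[𝕜] H, S.IsPositive → R.IsPositive → (S + R) * D = 0 → D * S * D = 0 := by
    intro S R hS hR hSR
    have pS : (D * S * D).IsPositive := by
      simpa [hD.adjoint_eq, mul_def, comp_assoc] using hS.conj_adjoint D
    have pR : (D * R * D).IsPositive := by
      simpa [hD.adjoint_eq, mul_def, comp_assoc] using hR.conj_adjoint D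
    have e : D * S * D = -(D * R * D) := by
      rw [eq_neg_iff_add_eq_zero, ← add_mul, ← mul_add, mul_assoc, hSR, mul_zero]
    have : ((D * S * D : H →L[𝕜] H) : H →ₗ[𝕜] H) = 0 := by
      rw [← pS.isSymmetric.inner_map_self_eq_zero]
      intro x
      have h1 := pS.inner_nonneg_left x
      have h2 := pR.inner_nonneg_left x
      have h3 : inner 𝕜 ((D * S * D) x) x = - inner 𝕜 ((D * R * D) x) x := by
        rw [e, neg_apply, inner_neg_left]
      refine le_antisymm ?_ h1
      show inner 𝕜 ((D * S * D) x) x ≤ 0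
      rw [h3]
      exact neg_nonpos.2 h2
    exact coe_injective this
  have hsum : (Q + G) * D = 0 := by
    rw [hDdef, ← hcomm.symm.mul_self_sub_mul_self_eq, h, sub_self]
  have h1 := key Q G hQ hG hsum
  have h2 := key G Q hG hQ (by rwa [add_comm])
  have h3 : D * D * D = 0 := by
    calc D * D * D = D * Q * D - D * G * D := by rw [← sub_mul, ← mul_sub, ← hDdef]
      _ = 0 := by rw [h1, h2, sub_zero]
  have sq0 : ∀ x, D (D x) = 0 → D x = 0 := fun x hx => by
    rw [← inner_self_eq_zero (𝕜 := 𝕜), hD.isSymmetric.apply_clm, hx, inner_zero_right]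
  have : D = 0 := by
    ext x
    have h4 : D (D (D x)) = 0 := congr($h3 x)
    exact sq0 _ (sq0 _ h4)
  exact sub_eq_zero.1 this

end ContinuousLinearMap
end

/-! ### Uniqueness of the square root and the bounded polar decomposition. -/

noncomputable section

namespace ContinuousLinearMap

variable {𝕜 H K : Type*} [RCLike 𝕜] [NormedAddCommGroup H] [InnerProductSpace 𝕜 H]
  [CompleteSpace H] [NormedAddCommGroup K] [InnerProductSpace 𝕜 K] [CompleteSpace K]

/-- `W* W` has exactly one positive square root. -/
theorem exists_unique_isPositive_mul_self_eq (W : H →L[𝕜] K) :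
    ∃ Q : H →L[𝕜] H, Q.IsPositive ∧ Q * Q = W.adjoint ∘L W ∧
      ∀ G : H →L[𝕜] H, G.IsPositive → G * G = W.adjoint ∘L W → G = Q := by
  obtain ⟨Q, hQ, hQQ, hcomm⟩ := exists_isPositive_mul_self_eq W
  refine ⟨Q, hQ, hQQ, fun G hG hGG => ?_⟩
  refine (hQ.eq_of_mul_self_eq hG (hcomm G ?_) (hQQ.trans hGG.symm)).symm
  rw [← hGG]
  exact (Commute.refl G).mul_right (Commute.refl G)

omit [CompleteSpace H] in
theorem eq_of_eqOn_of_eqOn_orthogonal {E : Type*} [NormedAddCommGroup E] [NormedSpace 𝕜 E]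
    {S R : H →L[𝕜] E} (M : Submodule 𝕜 H) [M.HasOrthogonalProjection]
    (h1 : ∀ x ∈ M, S x = R x) (h2 : ∀ x ∈ Mᗮ, S x = R x) : S = R := by
  ext x
  obtain ⟨y, hy, z, hz, rfl⟩ := M.exists_add_mem_mem_orthogonal x
  rw [map_add, map_add, h1 y hy, h2 z hz]

/-- The polar decomposition `W = U Q` of a bounded operator `W`. -/
theorem exists_partialIsometry_comp_eq {W : H →L[𝕜] K} {Q : H →L[𝕜] H} (hQ : Q.IsPositive)
    (hQQ : Q * Q = W.adjoint ∘L W) : ∃ U : H →L[𝕜] K, U ∘L Q = W ∧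
      U.kerᗮ = Q.range.topologicalClosure ∧ U.range = W.range.topologicalClosure ∧
      ∀ x ∈ U.kerᗮ, ‖U x‖ = ‖x‖ := by
  set M := Q.range.topologicalClosure with hM
  have hMc : IsClosed (M : Set H) := Submodule.isClosed_topologicalClosure _
  have : CompleteSpace M := hMc.completeSpace_coe
  have hnorm : ∀ x, ‖W x‖ = ‖Q x‖ := by
    intro x
    refine (sq_eq_sq₀ (norm_nonneg _) (norm_nonneg _)).1 ?_
    rw [← inner_self_eq_norm_sq (𝕜 := 𝕜), ← inner_self_eq_norm_sq (𝕜 := 𝕜), ← adjoint_inner_left,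
      ← hQ.inner_left_eq_inner_right]
    exact congr(RCLike.re (inner 𝕜 ($hQQ.symm x) x))
  let e : H →ₗ[𝕜] M := (Q : H →ₗ[𝕜] H).codRestrict M
    fun x => Submodule.le_topologicalClosure _ ⟨x, rfl⟩
  have he : DenseRange e := by
    intro m
    rw [Metric.mem_closure_iff]
    intro ε hε
    obtain ⟨_, ⟨x, rfl⟩, hx⟩ := Metric.mem_closure_iff.1 (show (m : H) ∈ closure _ from m.2) ε hε
    exact ⟨e x, ⟨x, rfl⟩, hx⟩
  have hbd : ∃ C, ∀ x, ‖(W : H →ₗ[𝕜] K) x‖ ≤ C * ‖e x‖ := ⟨1, fun x => by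
    rw [one_mul]; exact (hnorm x).le⟩
  -- As ‖W x‖ = ‖Q x‖, the map Q x ↦ W x is a well-defined isometry on R(Q) and extends to the
  -- closure; U is then zero on the orthogonal complement.
  set U₀ : M →L[𝕜] K := (W : H →ₗ[𝕜] K).extendOfNorm e with hU₀
  have hU₀e : ∀ x, U₀ (e x) = W x := LinearMap.extendOfNorm_eq he hbd
  have hU₀n : ∀ m, ‖U₀ m‖ = ‖m‖ := fun m =>
    he.induction_on (p := fun m => ‖U₀ m‖ = ‖m‖) m
      (isClosed_eq U₀.continuous.norm continuous_norm) fun x => by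
        rw [hU₀e]; exact hnorm x
  set U : H →L[𝕜] K := U₀ ∘L M.orthogonalProjectionOnto with hU
  have hUM : ∀ m : M, U m = U₀ m := fun m => by
    rw [hU, comp_apply, Submodule.orthogonalProjectionOnto_mem_subspace_eq_self]
  have hker : U.ker = Mᗮ := by
    ext x
    have : U x = 0 ↔ M.orthogonalProjectionOnto x = 0 := by
      rw [← norm_eq_zero, hU, comp_apply, hU₀n, norm_eq_zero]
    rw [← Submodule.orthogonalProjectionOnto_eq_zero_iff, ← this]
    rfl
  have hker' : U.kerᗮ = M := by rw [hker, Submodule.orthogonal_orthogonal]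
  refine ⟨U, ?_, hker', le_antisymm ?_ ?_, ?_⟩
  · ext x
    exact (hUM (e x)).trans (hU₀e x)
  · rintro _ ⟨x, rfl⟩
    refine he.induction_on (p := fun m => U₀ m ∈ W.range.topologicalClosure)
      (M.orthogonalProjectionOnto x)
      ((Submodule.isClosed_topologicalClosure _).preimage U₀.continuous) fun x => ?_
    rw [hU₀e]
    exact Submodule.le_topologicalClosure _ ⟨x, rfl⟩
  · refine Submodule.topologicalClosure_minimal _ ?_ ?_
    · rintro _ ⟨x, rfl⟩
      exact ⟨e x, (hUM (e x)).trans (hU₀e x)⟩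
    · have hr : (U.range : Set K) = Set.range U₀ := by
        ext y
        constructor
        · rintro ⟨x, rfl⟩
          exact ⟨_, rfl⟩
        · rintro ⟨m, rfl⟩
          exact ⟨m, hUM m⟩
      rw [hr]
      exact (AddMonoidHomClass.isometry_of_norm U₀ hU₀n).isClosedEmbedding.isClosed_range
  · intro x hx
    rw [hker'] at hx
    exact (congrArg norm (hUM ⟨x, hx⟩)).trans (hU₀n ⟨x, hx⟩)

end ContinuousLinearMap

/-! ### Partially defined operators through their graphs. -/

namespace LinearPMap

section Algebra

variable {R E F G : Type*} [Ring R] [AddCommGroup E] [Module R E] [AddCommGroup F] [Module R F]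
  [AddCommGroup G] [Module R G]

/-- Graphs compose as relations, which absorbs the bookkeeping of natural domains. -/
theorem mem_product_graph_iff {S : F →ₗ.[R] G} {T : E →ₗ.[R] F} {x : E} {z : G} :
    (x, z) ∈ (S.product T).graph ↔ ∃ y, (x, y) ∈ T.graph ∧ (y, z) ∈ S.graph := by
  have key : ∀ (hx : x ∈ (S.product T).domain) (h : x ∈ T.domain) (h' : T ⟨x, h⟩ ∈ S.domain),
      (S.product T) ⟨x, hx⟩ = S ⟨T ⟨x, h⟩, h'⟩ := by
    intro hx h h'
    refine congrArg S.toFun (Subtype.ext ?_)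
    exact domRestrict_apply rfl
  simp only [mem_graph_iff, Subtype.exists, exists_and_left, exists_eq_left]
  constructor
  · rintro ⟨hx, hz⟩
    obtain ⟨h, h'⟩ := exists_domain_of_mem_map S T x hx.1
    exact ⟨_, ⟨h, rfl⟩, h', by rw [← key hx h h', hz]⟩
  · rintro ⟨_, ⟨h, rfl⟩, h', rfl⟩
    exact ⟨⟨⟨⟨x, h⟩, h', rfl⟩, h⟩, key _ h h'⟩

theorem mem_toPMap_graph_iff {f : E →ₗ[R] F} {p : Submodule R E} {x : E} {y : F} :
    (x, y) ∈ (f.toPMap p).graph ↔ x ∈ p ∧ f x = y := by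
  simp only [mem_graph_iff, Subtype.exists, exists_and_left, exists_eq_left]
  exact ⟨fun ⟨h, h'⟩ => ⟨h, h'⟩, fun ⟨h, h'⟩ => ⟨h, h'⟩⟩

theorem mem_compPMap_graph_iff {g : F →ₗ[R] G} {f : E →ₗ.[R] F} {x : E} {z : G} :
    (x, z) ∈ (g.compPMap f).graph ↔ ∃ y, (x, y) ∈ f.graph ∧ g y = z := by
  simp only [mem_graph_iff, Subtype.exists, exists_and_left, exists_eq_left]
  constructor
  · rintro ⟨h, rfl⟩
    exact ⟨_, ⟨h, rfl⟩, rfl⟩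
  · rintro ⟨_, ⟨h, rfl⟩, rfl⟩
    exact ⟨h, rfl⟩

theorem mem_rangeSpace_iff {T : E →ₗ.[R] F} {y : F} :
    y ∈ T.rangeSpace ↔ ∃ x, (x, y) ∈ T.graph :=
  mem_range_iff

theorem mem_nullSpace_iff_graph {T : E →ₗ.[R] F} {x : E} :
    x ∈ T.nullSpace ↔ (x, 0) ∈ T.graph := by
  rw [mem_nullSpace_iff]
  simp

theorem ext_graph {S T : E →ₗ.[R] F} (h : ∀ x y, (x, y) ∈ S.graph ↔ (x, y) ∈ T.graph) : S = T :=
  eq_of_eq_graph (Submodule.ext fun p => h p.1 p.2)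

theorem eq_toPMap_top {T : E →ₗ.[R] F} {f : E →ₗ[R] F} (h : ∀ x, (x, f x) ∈ T.graph) :
    T = f.toPMap ⊤ := by
  refine ext_graph fun x y => ?_
  rw [mem_toPMap_graph_iff]
  refine ⟨fun hy => ⟨trivial, T.mem_graph_snd_inj (h x) hy rfl⟩, ?_⟩
  rintro ⟨-, rfl⟩
  exact h x

end Algebra

section Adjoint

variable {𝕜 H K : Type*} [RCLike 𝕜] [NormedAddCommGroup H] [InnerProductSpace 𝕜 H]
  [CompleteSpace H] [NormedAddCommGroup K] [InnerProductSpace 𝕜 K]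

theorem mem_adjoint_graph_iff {T : H →ₗ.[𝕜] K} (hT : Dense (T.domain : Set H)) {y : K} {x : H} :
    (y, x) ∈ T.adjoint.graph ↔ ∀ a b, (a, b) ∈ T.graph → inner 𝕜 b y = inner 𝕜 a x := by
  rw [adjoint_graph_eq_graph_adjoint hT, Submodule.mem_adjoint_iff]
  simp only [sub_eq_zero]

end Adjoint

end LinearPMap
end

/-! ### Moore-Penrose inverses of bounded operators. -/

noncomputable section

namespace LinearPMap

variable {𝕜 H K : Type*} [RCLike 𝕜] [NormedAddCommGroup H] [InnerProductSpace 𝕜 H]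
  [CompleteSpace H] [NormedAddCommGroup K] [InnerProductSpace 𝕜 K] [CompleteSpace K]

/-- The graph of the Moore-Penrose inverse of a bounded operator `B`. -/
def generalizedInverseGraph (B : K →L[𝕜] H) : Submodule 𝕜 (H × K) where
  carrier := {p | B.adjoint (p.1 - B p.2) = 0 ∧ p.2 ∈ B.kerᗮ}
  add_mem' := by
    rintro ⟨x, y⟩ ⟨x', y'⟩ ⟨h, hy⟩ ⟨h', hy'⟩
    refine ⟨?_, add_mem hy hy'⟩
    change B.adjoint (x + x' - B (y + y')) = 0
    rw [_root_.map_add, add_sub_add_comm, _root_.map_add, h, h', add_zero]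
  zero_mem' := by simp
  smul_mem' := by
    rintro c ⟨x, y⟩ ⟨h, hy⟩
    refine ⟨?_, Submodule.smul_mem _ c hy⟩
    change B.adjoint (c • x - B (c • y)) = 0
    rw [_root_.map_smul, ← smul_sub, _root_.map_smul, h, smul_zero]

/-- The Moore-Penrose inverse of a bounded operator `B`, described by its graph
`{(B k + n, k) | k ∈ N(B)ᗮ, n ∈ R(B)ᗮ}`. -/
def generalizedInverse (B : K →L[𝕜] H) : H →ₗ.[𝕜] K :=
  (generalizedInverseGraph B).toLinearPMap

theorem _root_.ContinuousLinearMap.apply_eq_zero_of_adjoint_apply_eq_zero {B : K →L[𝕜] H} {y : K}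
    (h : B.adjoint (B y) = 0) : B y = 0 := by
  rw [← inner_self_eq_zero (𝕜 := 𝕜), ← ContinuousLinearMap.adjoint_inner_left, h, inner_zero_left]

theorem mem_generalizedInverse_graph_iff {B : K →L[𝕜] H} {x : H} {y : K} :
    (x, y) ∈ (generalizedInverse B).graph ↔ B.adjoint (x - B y) = 0 ∧ y ∈ B.kerᗮ := by
  rw [generalizedInverse, Submodule.toLinearPMap_graph_eq]
  · rfl
  · rintro ⟨x, y⟩ ⟨h, hy⟩ (rfl : x = 0)
    rw [zero_sub, _root_.map_neg, neg_eq_zero] at h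
    exact inner_self_eq_zero.1
      ((Submodule.mem_orthogonal _ _).1 hy y
        (ContinuousLinearMap.apply_eq_zero_of_adjoint_apply_eq_zero h))

theorem mem_graph_generalizedInverse_apply {B : K →L[𝕜] H} {y : K} (hy : y ∈ B.kerᗮ) :
    (B y, y) ∈ (generalizedInverse B).graph :=
  mem_generalizedInverse_graph_iff.2 ⟨by simp, hy⟩

theorem _root_.ContinuousLinearMap.adjoint_apply_mem_ker_orthogonal (B : K →L[𝕜] H) (x : H) :
    B.adjoint x ∈ B.kerᗮ := by
  rw [B.orthogonal_ker]
  exact Submodule.le_topologicalClosure _ ⟨x, rfl⟩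

omit [CompleteSpace H] in
theorem _root_.ContinuousLinearMap.exists_mem_ker_orthogonal_apply_eq (B : K →L[𝕜] H) (y : K) :
    ∃ k ∈ B.kerᗮ, B k = B y := by
  obtain ⟨n, hn, k, hk, rfl⟩ := B.ker.exists_add_mem_mem_orthogonal y
  refine ⟨k, hk, ?_⟩
  rw [_root_.map_add, show B n = 0 from hn, zero_add]

/-- A vector orthogonal to the domain is orthogonal to R(B), so it lies in N(B*), which is itself
part of the domain. -/
theorem dense_domain_generalizedInverse (B : K →L[𝕜] H) :
    Dense ((generalizedInverse B).domain : Set H) := by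
  rw [Submodule.dense_iff_topologicalClosure_eq_top, Submodule.topologicalClosure_eq_top_iff,
    Submodule.eq_bot_iff]
  intro x hx
  have h1 : B.adjoint x = 0 := by
    refine ext_inner_left 𝕜 fun k => ?_
    rw [inner_zero_right, ContinuousLinearMap.adjoint_inner_right]
    obtain ⟨m, hm, hmk⟩ := B.exists_mem_ker_orthogonal_apply_eq k
    rw [← hmk]
    exact (Submodule.mem_orthogonal _ _).1 hx _
      (mem_domain_of_mem_graph (mem_graph_generalizedInverse_apply hm))
  have h2 : (x, (0 : K)) ∈ (generalizedInverse B).graph :=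
    mem_generalizedInverse_graph_iff.2 ⟨by simpa using h1, zero_mem _⟩
  exact inner_self_eq_zero.1 ((Submodule.mem_orthogonal _ _).1 hx x (mem_domain_of_mem_graph h2))

theorem rangeSpace_generalizedInverse (B : K →L[𝕜] H) :
    (generalizedInverse B).rangeSpace = B.kerᗮ := by
  ext y
  rw [mem_rangeSpace_iff]
  exact ⟨fun ⟨x, hx⟩ => (mem_generalizedInverse_graph_iff.1 hx).2,
    fun hy => ⟨_, mem_graph_generalizedInverse_apply hy⟩⟩

theorem nullSpace_generalizedInverse (B : K →L[𝕜] H) :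
    (generalizedInverse B).nullSpace = B.adjoint.ker := by
  ext x
  rw [mem_nullSpace_iff_graph, mem_generalizedInverse_graph_iff]
  simp

/-- Range and null space of B† recover N(B) and N(B*). For y ⊥ N(B), the vector B y - C y lies in
N(C*) = N(B*), so it is orthogonal to both ranges and to itself. -/
theorem generalizedInverse_injective :
    Function.Injective (generalizedInverse : (K →L[𝕜] H) → (H →ₗ.[𝕜] K)) := by
  intro B C h
  have hk : B.ker = C.ker := by
    have := congrArg rangeSpace h
    rw [rangeSpace_generalizedInverse, rangeSpace_generalizedInverse] at this
    rw [← B.ker.orthogonal_orthogonal, this, C.ker.orthogonal_orthogonal]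
  have hn : B.adjoint.ker = C.adjoint.ker := by
    rw [← nullSpace_generalizedInverse, h, nullSpace_generalizedInverse]
  refine ContinuousLinearMap.eq_of_eqOn_of_eqOn_orthogonal B.kerᗮ (fun y hy => ?_) fun y hy => ?_
  · have h1 : C.adjoint (B y - C y) = 0 :=
      (mem_generalizedInverse_graph_iff.1 (h ▸ mem_graph_generalizedInverse_apply hy)).1
    have h2 : B.adjoint (B y - C y) = 0 := by
      have : B y - C y ∈ C.adjoint.ker := h1
      rwa [← hn] at this
    rw [← sub_eq_zero, ← inner_self_eq_zero (𝕜 := 𝕜)]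
    rw [inner_sub_right]
    rw [← ContinuousLinearMap.adjoint_inner_left, ← ContinuousLinearMap.adjoint_inner_left, h1, h2]
    simp
  · rw [Submodule.orthogonal_orthogonal] at hy
    have hy' : y ∈ C.ker := hk ▸ hy
    exact (show B y = 0 from hy).trans (show C y = 0 from hy').symm

theorem adjoint_generalizedInverse (B : K →L[𝕜] H) :
    (generalizedInverse B).adjoint = generalizedInverse B.adjoint := by
  refine ext_graph fun y x => ?_
  rw [mem_adjoint_graph_iff (dense_domain_generalizedInverse B), mem_generalizedInverse_graph_iff,
    ContinuousLinearMap.adjoint_adjoint]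
  constructor
  · intro h
    -- The pairs (n, 0) with n in N(B*) and (B k, k) with k ⊥ N(B) suffice as tests.
    have hx : x ∈ B.adjoint.kerᗮ := by
      refine (Submodule.mem_orthogonal _ _).2 fun n hn => ?_
      rw [← h n 0 (mem_generalizedInverse_graph_iff.2 ⟨by simpa using hn, zero_mem _⟩),
        inner_zero_left]
    refine ⟨?_, hx⟩
    have : y - B.adjoint x ∈ B.kerᗮᗮ := by
      refine (Submodule.mem_orthogonal _ _).2 fun k hk => ?_
      rw [inner_sub_right, h _ k (mem_graph_generalizedInverse_apply hk),
        ContinuousLinearMap.adjoint_inner_right, sub_self]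
    rwa [Submodule.orthogonal_orthogonal] at this
  · rintro ⟨h1, h2⟩ a b hab
    obtain ⟨h3, h4⟩ := mem_generalizedInverse_graph_iff.1 hab
    have h5 : inner 𝕜 (a - B b) x = 0 := (Submodule.mem_orthogonal _ _).1 h2 _ h3
    have h6 : inner 𝕜 b (y - B.adjoint x) = 0 := (Submodule.mem_orthogonal' _ _).1 h4 _ h1
    rw [inner_sub_left, sub_eq_zero] at h5
    rw [inner_sub_right, sub_eq_zero, ContinuousLinearMap.adjoint_inner_right] at h6
    rw [h5, h6]

theorem adjoint_product_generalizedInverse (B : K →L[𝕜] H) :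
    (generalizedInverse B).adjoint.product (generalizedInverse B) =
      generalizedInverse (B ∘L B.adjoint) := by
  have hadj : (B ∘L B.adjoint).adjoint = B ∘L B.adjoint := by
    rw [ContinuousLinearMap.adjoint_comp, ContinuousLinearMap.adjoint_adjoint]
  have hker : (B ∘L B.adjoint).ker = B.adjoint.ker := by
    simpa using B.adjoint.ker_adjoint_comp_self
  refine ext_graph fun x z => ?_
  rw [mem_product_graph_iff, adjoint_generalizedInverse, mem_generalizedInverse_graph_iff, hadj,
    hker]
  simp only [mem_generalizedInverse_graph_iff, ContinuousLinearMap.adjoint_adjoint]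
  constructor
  · rintro ⟨y, ⟨h1, h2⟩, h3, h4⟩
    refine ⟨?_, h4⟩
    -- The intermediate vector is forced: y - B* z lies in N(B) and in its orthogonal complement.
    have hy : y = B.adjoint z := by
      rw [← sub_eq_zero]
      exact inner_self_eq_zero.1 ((Submodule.mem_orthogonal _ _).1
        (sub_mem h2 (B.adjoint_apply_mem_ker_orthogonal z)) _ h3)
    subst hy
    change B (B.adjoint (x - B (B.adjoint z))) = 0
    rw [h1, _root_.map_zero]
  · rintro ⟨h1, h2⟩
    refine ⟨B.adjoint z, ⟨?_, B.adjoint_apply_mem_ker_orthogonal z⟩, by simp, h2⟩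
    have h3 : x - B (B.adjoint z) ∈ (B ∘L B.adjoint).ker := h1
    rwa [hker] at h3

theorem moorePenrose_generalizedInverse (B : K →L[𝕜] H) :
    (generalizedInverse B).moorePenrose = (B : K →ₗ[𝕜] H).toPMap ⊤ := by
  set S := generalizedInverse B with hS
  refine eq_toPMap_top fun y => ?_
  obtain ⟨n, hn, k, hk, rfl⟩ := B.ker.exists_add_mem_mem_orthogonal y
  have h1 : (n, (0 : H)) ∈ S.moorePenrose.graph := by
    refine le_graph_of_le (LinearPMap.right_le_sup _ _ _) ?_
    rw [mem_toPMap_graph_iff]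
    refine ⟨?_, rfl⟩
    rwa [rangeSpace_generalizedInverse, Submodule.orthogonal_orthogonal]
  have h2 : (k, B k) ∈ S.moorePenrose.graph := by
    refine le_graph_of_le (LinearPMap.left_le_sup _ _ _) ?_
    have hkS : (B k, k) ∈ S.graph := mem_graph_generalizedInverse_apply hk
    have hd : B k ∈ S.domain := mem_domain_of_mem_graph hkS
    have hN : B k ∈ S.nullSpaceᗮ := by
      rw [nullSpace_generalizedInverse]
      simpa using B.adjoint.adjoint_apply_mem_ker_orthogonal k
    have e : S.carrierRestrict ⟨B k, hN, hd⟩ = S ⟨B k, hd⟩ := domRestrict_apply rfl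
    have e' : S ⟨B k, hd⟩ = k := S.mem_graph_snd_inj (S.mem_graph ⟨B k, hd⟩) hkS rfl
    have := mem_inverse_graph (ker_carrierRestrict S) ⟨B k, hN, hd⟩
    rwa [e, e'] at this
  have h3 := add_mem h1 h2
  rw [Prod.mk_add_mk, zero_add] at h3
  have e : (B : K →ₗ[𝕜] H) (n + k) = B k := by
    change B (n + k) = B k
    rw [_root_.map_add, show B n = 0 from hn, zero_add]
  rwa [e]

/-- This is B† B B* = B*, valid because R(B*) ⊥ N(B). -/
theorem cauchyDual_generalizedInverse (B : K →L[𝕜] H) :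
    (generalizedInverse B).cauchyDual = (B.adjoint : H →ₗ[𝕜] K).toPMap ⊤ := by
  refine eq_toPMap_top fun x => ?_
  rw [cauchyDual, adjoint_product_generalizedInverse, moorePenrose_generalizedInverse,
    mem_product_graph_iff]
  exact ⟨_, mem_toPMap_graph_iff.2 ⟨trivial, rfl⟩,
    mem_graph_generalizedInverse_apply (B.adjoint_apply_mem_ker_orthogonal x)⟩

/-- A densely defined closed operator with closed range is the Moore-Penrose inverse of a bounded
operator. -/
theorem exists_eq_generalizedInverse {T : H →ₗ.[𝕜] K} (hclosed : T.IsClosed)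
    (hdense : Dense (T.domain : Set H)) (hrange : _root_.IsClosed (T.rangeSpace : Set K)) :
    ∃ B : K →L[𝕜] H, T = generalizedInverse B := by
  have hgc : _root_.IsClosed (T.graph : Set (H × K)) := hclosed
  have hNc : _root_.IsClosed (T.nullSpace : Set H) := by
    have : (T.nullSpace : Set H) = (fun x => (x, (0 : K))) ⁻¹' (T.graph : Set (H × K)) := by
      ext x
      exact mem_nullSpace_iff_graph
    rw [this]
    exact hgc.preimage (by fun_prop)
  have : CompleteSpace T.nullSpace := hNc.completeSpace_coe
  have : CompleteSpace T.rangeSpace := hrange.completeSpace_coe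
  have huniq : ∀ x x' y, (x, y) ∈ T.graph → x ∈ T.nullSpaceᗮ → (x', y) ∈ T.graph →
      x' ∈ T.nullSpaceᗮ → x = x' := by
    intro x x' y h hx h' hx'
    have h1 := sub_mem h h'
    rw [Prod.mk_sub_mk, sub_self, ← mem_nullSpace_iff_graph] at h1
    rw [← sub_eq_zero]
    exact inner_self_eq_zero.1 ((Submodule.mem_orthogonal _ _).1 (sub_mem hx hx') _ h1)
  have hex : ∀ y : T.rangeSpace, ∃ x, (x, (y : K)) ∈ T.graph ∧ x ∈ T.nullSpaceᗮ := by
    rintro ⟨y, hy⟩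
    obtain ⟨x, hx⟩ := mem_rangeSpace_iff.1 hy
    obtain ⟨n, hn, m, hm, rfl⟩ := T.nullSpace.exists_add_mem_mem_orthogonal x
    refine ⟨m, ?_, hm⟩
    simpa using sub_mem hx (mem_nullSpace_iff_graph.1 hn)
  -- f sends y in R(T) to its unique preimage orthogonal to N(T); extended by zero on R(T)ᗮ it
  -- becomes T†.
  choose f hf hfN using hex
  let g : T.rangeSpace →ₗ[𝕜] H :=
    { toFun := f
      map_add' := fun y y' => huniq _ _ _ (hf _) (hfN _)
        (add_mem (hf y) (hf y')) (add_mem (hfN y) (hfN y'))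
      map_smul' := fun c y => huniq _ _ _ (hf _) (hfN _)
        (Submodule.smul_mem _ c (hf y)) (Submodule.smul_mem _ c (hfN y)) }
  have hg : Continuous g := by
    refine g.continuous_of_seq_closed_graph fun u y x hu hgu => ?_
    refine huniq _ _ y ?_ ?_ (hf y) (hfN y)
    · exact hgc.mem_of_tendsto
        (hgu.prodMk_nhds ((continuous_subtype_val.tendsto y).comp hu))
        (Filter.Eventually.of_forall fun n => hf (u n))
    · exact T.nullSpace.isClosed_orthogonal.mem_of_tendsto hgu
        (Filter.Eventually.of_forall fun n => hfN (u n))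
  let B : K →L[𝕜] H := (⟨g, hg⟩ : T.rangeSpace →L[𝕜] H) ∘L T.rangeSpace.orthogonalProjectionOnto
  have hBR : ∀ y (hy : y ∈ T.rangeSpace), B y = f ⟨y, hy⟩ := fun y hy =>
    congrArg f (T.rangeSpace.orthogonalProjectionOnto_mem_subspace_eq_self ⟨y, hy⟩)
  have hker : B.ker = T.rangeSpaceᗮ := by
    ext y
    rw [← Submodule.orthogonalProjectionOnto_eq_zero_iff]
    constructor
    · intro h
      have h0 : f (T.rangeSpace.orthogonalProjectionOnto y) = 0 := h
      have h1 := hf (T.rangeSpace.orthogonalProjectionOnto y)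
      rw [h0] at h1
      exact Subtype.ext (T.graph_fst_eq_zero_snd h1 rfl)
    · intro h
      change g (T.rangeSpace.orthogonalProjectionOnto y) = 0
      rw [h, _root_.map_zero]
  have hker' : B.kerᗮ = T.rangeSpace := by rw [hker, Submodule.orthogonal_orthogonal]
  -- Density of D(T) enters here: the part of D(T) orthogonal to N(T) lies in R(B), so a vector
  -- orthogonal to both R(B) and N(T) is orthogonal to D(T).
  have hadj : B.adjoint.ker = T.nullSpace := by
    rw [← B.orthogonal_range]
    refine le_antisymm (fun x hx => ?_) fun x hx => ?_
    · obtain ⟨n, hn, m, hm, rfl⟩ := T.nullSpace.exists_add_mem_mem_orthogonal x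
      have hm0 : m = 0 := by
        refine hdense.eq_zero_of_inner_right 𝕜 fun d hd => ?_
        obtain ⟨y, hy⟩ := mem_domain_iff.1 hd
        obtain ⟨d₁, hd₁, d₂, hd₂, rfl⟩ := T.nullSpace.exists_add_mem_mem_orthogonal d
        have hd₂y : (d₂, y) ∈ T.graph := by
          simpa using sub_mem hy (mem_nullSpace_iff_graph.1 hd₁)
        have hyR : y ∈ T.rangeSpace := mem_rangeSpace_iff.2 ⟨_, hd₂y⟩
        have hBy : B y = d₂ := (hBR y hyR).trans (huniq _ _ y (hf ⟨y, hyR⟩) (hfN _) hd₂y hd₂)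
        have h1 : inner 𝕜 d₂ (n + m) = 0 := (Submodule.mem_orthogonal _ _).1 hx _ ⟨y, hBy⟩
        rw [inner_add_right, (Submodule.mem_orthogonal' _ _).1 hd₂ n hn, zero_add] at h1
        rw [inner_add_left, h1, (Submodule.mem_orthogonal _ _).1 hm d₁ hd₁, zero_add]
      rwa [hm0, add_zero]
    · refine (Submodule.mem_orthogonal _ _).2 ?_
      rintro _ ⟨y, rfl⟩
      exact (Submodule.mem_orthogonal' _ _).1 (hfN _) x hx
  refine ⟨B, ext_graph fun x y => ?_⟩
  rw [mem_generalizedInverse_graph_iff, hker']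
  have hx : B.adjoint (x - B y) = 0 ↔ x - B y ∈ T.nullSpace := by rw [← hadj]; rfl
  rw [hx, mem_nullSpace_iff_graph]
  have hBy : y ∈ T.rangeSpace → (B y, y) ∈ T.graph := fun hy => by
    rw [hBR y hy]
    exact hf ⟨y, hy⟩
  constructor
  · intro h
    have hy : y ∈ T.rangeSpace := mem_rangeSpace_iff.2 ⟨x, h⟩
    refine ⟨?_, hy⟩
    simpa using sub_mem h (hBy hy)
  · rintro ⟨h, hy⟩
    simpa using add_mem h (hBy hy)

end LinearPMap
end

/-! ### Moduli and polar decompositions of B† and of bounded operators. -/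

noncomputable section

namespace LinearPMap

variable {𝕜 H K : Type*} [RCLike 𝕜] [NormedAddCommGroup H] [InnerProductSpace 𝕜 H]
  [CompleteSpace H] [NormedAddCommGroup K] [InnerProductSpace 𝕜 K] [CompleteSpace K]

omit [CompleteSpace K] in
theorem IsPolarDecomposition.eq_of_modulus_eq {T : H →ₗ.[𝕜] K} {U V : H →L[𝕜] K}
    {A : H →ₗ.[𝕜] H} (hU : T.IsPolarDecomposition U A) (hV : T.IsPolarDecomposition V A) :
    U = V := by
  refine ContinuousLinearMap.eq_of_eqOn_of_eqOn_orthogonal U.kerᗮ (fun x hx => ?_) fun x hx => ?_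
  · rw [hU.initial] at hx
    refine Set.EqOn.closure (s := (A.rangeSpace : Set H)) ?_ U.continuous V.continuous hx
    rintro _ ⟨y, rfl⟩
    have h := hU.eq_comp.symm.trans hV.eq_comp
    have h1 : ((y : H), U (A y)) ∈ ((U : H →ₗ[𝕜] K).compPMap A).graph :=
      mem_compPMap_graph_iff.2 ⟨_, A.mem_graph y, rfl⟩
    have h2 : ((y : H), V (A y)) ∈ ((V : H →ₗ[𝕜] K).compPMap A).graph :=
      mem_compPMap_graph_iff.2 ⟨_, A.mem_graph y, rfl⟩
    rw [h] at h1
    exact mem_graph_snd_inj _ h1 h2 rfl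
  · have hx' : x ∈ V.kerᗮᗮ := by rwa [hV.initial, ← hU.initial]
    rw [Submodule.orthogonal_orthogonal] at hx hx'
    exact (show U x = 0 from hx).trans (show V x = 0 from hx').symm

omit [CompleteSpace K] in
theorem IsPolarDecomposition.modulus_eq {T : H →ₗ.[𝕜] K} {U : H →L[𝕜] K}
    {A : H →ₗ.[𝕜] H} (hU : T.IsPolarDecomposition U A) (hA : ∀ A', T.IsModulus A' → A' = A) :
    T.modulus = A := by
  have h : ∃ A, T.IsModulus A := ⟨A, hU.isModulus⟩
  rw [modulus, dif_pos h]
  exact hA _ h.choose_spec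

omit [CompleteSpace K] in
theorem IsPolarDecomposition.polarIsometry_eq {T : H →ₗ.[𝕜] K} {U : H →L[𝕜] K}
    {A : H →ₗ.[𝕜] H} (hU : T.IsPolarDecomposition U A) (hA : ∀ A', T.IsModulus A' → A' = A) :
    T.polarIsometry = U := by
  have hm := hU.modulus_eq hA
  have h : ∃ U, T.IsPolarDecomposition U T.modulus := ⟨U, hm ▸ hU⟩
  rw [polarIsometry, dif_pos h]
  refine IsPolarDecomposition.eq_of_modulus_eq h.choose_spec ?_
  rwa [hm]

omit [CompleteSpace K] in
theorem IsPolarDecomposition.isPolarDecomposition_polarIsometry_modulus {T : H →ₗ.[𝕜] K}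
    {U : H →L[𝕜] K} {A : H →ₗ.[𝕜] H} (hU : T.IsPolarDecomposition U A)
    (hA : ∀ A', T.IsModulus A' → A' = A) :
    T.IsPolarDecomposition T.polarIsometry T.modulus ∧
      ∀ (V : H →L[𝕜] K) (A' : H →ₗ.[𝕜] H), T.IsPolarDecomposition V A' →
        V = T.polarIsometry ∧ A' = T.modulus := by
  rw [hU.polarIsometry_eq hA, hU.modulus_eq hA]
  refine ⟨hU, fun V A' hV => ?_⟩
  obtain rfl := hA A' hV.isModulus
  exact ⟨hV.eq_of_modulus_eq hU, rfl⟩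

theorem isSelfAdjoint_generalizedInverse_iff {G : H →L[𝕜] H} :
    IsSelfAdjoint (generalizedInverse G) ↔ G.adjoint = G := by
  rw [isSelfAdjoint_def, adjoint_generalizedInverse, generalizedInverse_injective.eq_iff]

/-- With y = Q† x, the vector x - Q y lies in N(Q) and y ⊥ N(Q), so ⟨y, x⟩ = ⟨y, Q y⟩. -/
theorem inner_nonneg_generalizedInverse {Q : H →L[𝕜] H} (hQ : Q.IsPositive)
    (x : (generalizedInverse Q).domain) :
    0 ≤ RCLike.re (inner 𝕜 (generalizedInverse Q x) (x : H)) := by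
  obtain ⟨h1, h2⟩ := mem_generalizedInverse_graph_iff.1 ((generalizedInverse Q).mem_graph x)
  rw [hQ.isSelfAdjoint.adjoint_eq] at h1
  have h3 := (Submodule.mem_orthogonal' _ _).1 h2 _ h1
  rw [inner_sub_right, sub_eq_zero] at h3
  rw [h3]
  exact hQ.re_inner_nonneg_right _

theorem isPositive_of_inner_nonneg_generalizedInverse {G : H →L[𝕜] H} (hG : G.adjoint = G)
    (h : ∀ x : (generalizedInverse G).domain,
      0 ≤ RCLike.re (inner 𝕜 (generalizedInverse G x) (x : H))) : G.IsPositive := by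
  have hsymm : (G : H →ₗ[𝕜] H).IsSymmetric :=
    ContinuousLinearMap.isSelfAdjoint_iff_isSymmetric.1 hG
  refine ContinuousLinearMap.isPositive_def.2 ⟨hsymm, fun y => ?_⟩
  obtain ⟨k, hk, hky⟩ := G.exists_mem_ker_orthogonal_apply_eq y
  have hgr := mem_graph_generalizedInverse_apply hk
  have h1 := h ⟨G k, mem_domain_of_mem_graph hgr⟩
  rw [mem_graph_snd_inj _ (mem_graph _ _) hgr rfl] at h1
  have h2 : inner 𝕜 (G y) y = inner 𝕜 k (G k) := by
    rw [← hky]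
    refine (hsymm k y).trans ?_
    exact congrArg (inner 𝕜 k) hky.symm
  rwa [ContinuousLinearMap.reApplyInnerSelf_apply, h2]

theorem isModulus_generalizedInverse {B : K →L[𝕜] H} {Q : H →L[𝕜] H} (hQ : Q.IsPositive)
    (hQQ : Q * Q = B ∘L B.adjoint) :
    (generalizedInverse B).IsModulus (generalizedInverse Q) := by
  have hQa := hQ.isSelfAdjoint.adjoint_eq
  have hsa := isSelfAdjoint_generalizedInverse_iff.2 hQa
  refine ⟨hsa, inner_nonneg_generalizedInverse hQ, ?_⟩
  have h := adjoint_product_generalizedInverse Q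
  rw [isSelfAdjoint_def.1 hsa, hQa] at h
  rw [h, adjoint_product_generalizedInverse, ← hQQ]
  rfl

theorem mem_nullSpace_of_mem_nullSpace_product_self {A : H →ₗ.[𝕜] H}
    (hA : IsSelfAdjoint A) {x : H} (hx : x ∈ (A.product A).nullSpace) : x ∈ A.nullSpace := by
  rw [mem_nullSpace_iff_graph, mem_product_graph_iff] at hx
  obtain ⟨y, hy, hy0⟩ := hx
  rw [← isSelfAdjoint_def.1 hA, mem_adjoint_graph_iff hA.dense_domain] at hy0
  have : y = 0 := by
    rw [← inner_self_eq_zero (𝕜 := 𝕜), hy0 x y hy, inner_zero_right]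
  rwa [this, ← mem_nullSpace_iff_graph] at hy

/-- From A² = (B B*)† one gets R(A) = N(B B*)ᗮ, which is closed. So A is itself some G†, and
injectivity of † turns the equation into G² = B B*. -/
theorem IsModulus.eq_generalizedInverse {B : K →L[𝕜] H} {Q : H →L[𝕜] H}
    (hQ : ∀ G : H →L[𝕜] H, G.IsPositive → G * G = B ∘L B.adjoint → G = Q)
    {A : H →ₗ.[𝕜] H} (hA : (generalizedInverse B).IsModulus A) : A = generalizedInverse Q := by
  have hsa := hA.isSelfAdjoint
  have hdense := hsa.dense_domain
  have hsq := hA.sq_eq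
  rw [adjoint_product_generalizedInverse] at hsq
  have hPa : (B ∘L B.adjoint).adjoint = B ∘L B.adjoint := by
    rw [ContinuousLinearMap.adjoint_comp, ContinuousLinearMap.adjoint_adjoint]
  have hrange : A.rangeSpace = (B ∘L B.adjoint).kerᗮ := by
    refine le_antisymm (fun y hy => ?_) fun y hy => ?_
    · obtain ⟨x, hx⟩ := mem_rangeSpace_iff.1 hy
      rw [← isSelfAdjoint_def.1 hsa, mem_adjoint_graph_iff hdense] at hx
      refine (Submodule.mem_orthogonal _ _).2 fun n hn => ?_
      have hn' : n ∈ (A.product A).nullSpace := by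
        rwa [hsq, nullSpace_generalizedInverse, hPa]
      have hn0 := mem_nullSpace_iff_graph.1 (mem_nullSpace_of_mem_nullSpace_product_self hsa hn')
      rw [← hx n 0 hn0, inner_zero_left]
    · rw [← rangeSpace_generalizedInverse, ← hsq, mem_rangeSpace_iff] at hy
      obtain ⟨x, hx⟩ := hy
      obtain ⟨z, -, hz⟩ := mem_product_graph_iff.1 hx
      exact mem_rangeSpace_iff.2 ⟨z, hz⟩
  obtain ⟨G, rfl⟩ := exists_eq_generalizedInverse hsa.isClosed hdense
    (hrange ▸ Submodule.isClosed_orthogonal _)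
  have hGa := isSelfAdjoint_generalizedInverse_iff.1 hsa
  have hG2 := adjoint_product_generalizedInverse G
  rw [isSelfAdjoint_def.1 hsa, hGa, hsq, generalizedInverse_injective.eq_iff] at hG2
  rw [hQ G (isPositive_of_inner_nonneg_generalizedInverse hGa hA.nonneg) hG2.symm]

theorem adjoint_product_toPMap_top (W : H →L[𝕜] K) :
    ((W : H →ₗ[𝕜] K).toPMap ⊤).adjoint.product ((W : H →ₗ[𝕜] K).toPMap ⊤) =
      ((W.adjoint ∘L W : H →L[𝕜] H) : H →ₗ[𝕜] H).toPMap ⊤ := by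
  refine eq_toPMap_top fun x => ?_
  rw [W.toPMap_adjoint_eq_adjoint_toPMap_of_dense (by simp), mem_product_graph_iff]
  exact ⟨W x, mem_toPMap_graph_iff.2 ⟨trivial, rfl⟩, mem_toPMap_graph_iff.2 ⟨trivial, rfl⟩⟩

theorem isSelfAdjoint_toPMap_top_iff {Q : H →L[𝕜] H} :
    IsSelfAdjoint ((Q : H →ₗ[𝕜] H).toPMap ⊤) ↔ Q.adjoint = Q := by
  rw [isSelfAdjoint_def, Q.toPMap_adjoint_eq_adjoint_toPMap_of_dense (by simp)]
  refine ⟨fun h => ?_, fun h => by rw [h]⟩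
  ext x
  have h1 : (x, Q.adjoint x) ∈ ((Q.adjoint : H →ₗ[𝕜] H).toPMap ⊤).graph :=
    mem_toPMap_graph_iff.2 ⟨trivial, rfl⟩
  rw [h] at h1
  exact (mem_toPMap_graph_iff.1 h1).2.symm

theorem isModulus_toPMap_top {W : H →L[𝕜] K} {Q : H →L[𝕜] H} (hQ : Q.IsPositive)
    (hQQ : Q * Q = W.adjoint ∘L W) :
    ((W : H →ₗ[𝕜] K).toPMap ⊤).IsModulus ((Q : H →ₗ[𝕜] H).toPMap ⊤) := by
  have hQa := hQ.isSelfAdjoint.adjoint_eq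
  have hsa := isSelfAdjoint_toPMap_top_iff.2 hQa
  refine ⟨hsa, fun x => hQ.re_inner_nonneg_left x, ?_⟩
  have h := adjoint_product_toPMap_top Q
  rw [isSelfAdjoint_def.1 hsa, hQa] at h
  rw [h, adjoint_product_toPMap_top, ← hQQ]
  rfl

/-- Since A² is everywhere defined, so is A; a symmetric everywhere defined operator is bounded
(Hellinger-Toeplitz), and uniqueness of the bounded root applies. -/
theorem IsModulus.eq_toPMap_top {W : H →L[𝕜] K} {Q : H →L[𝕜] H}
    (hQ : ∀ G : H →L[𝕜] H, G.IsPositive → G * G = W.adjoint ∘L W → G = Q)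
    {A : H →ₗ.[𝕜] H} (hA : ((W : H →ₗ[𝕜] K).toPMap ⊤).IsModulus A) :
    A = (Q : H →ₗ[𝕜] H).toPMap ⊤ := by
  have hsa := hA.isSelfAdjoint
  have hsq := hA.sq_eq
  rw [adjoint_product_toPMap_top] at hsq
  have hex : ∀ x, ∃ y, (x, y) ∈ A.graph ∧ (y, W.adjoint (W x)) ∈ A.graph := fun x => by
    rw [← mem_product_graph_iff, hsq, mem_toPMap_graph_iff]
    exact ⟨trivial, rfl⟩
  choose f hf hff using hex
  let g : H →ₗ[𝕜] H :=
    { toFun := f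
      map_add' := fun x y => A.mem_graph_snd_inj (hf _) (add_mem (hf x) (hf y)) rfl
      map_smul' := fun c x => A.mem_graph_snd_inj (hf _) (Submodule.smul_mem _ c (hf x)) rfl }
  have hg : g.IsSymmetric := by
    intro x y
    have h := hf y
    rw [← isSelfAdjoint_def.1 hsa, mem_adjoint_graph_iff hsa.dense_domain] at h
    exact h _ _ (hf x)
  let G : H →L[𝕜] H := ⟨g, hg.continuous⟩
  have hGgr : ∀ x, (x, G x) ∈ A.graph := hf
  have hAG : A = (G : H →ₗ[𝕜] H).toPMap ⊤ := LinearPMap.eq_toPMap_top hf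
  have hpos : G.IsPositive := by
    refine ContinuousLinearMap.isPositive_def.2 ⟨hg, fun x => ?_⟩
    have h := hA.nonneg ⟨x, mem_domain_of_mem_graph (hGgr x)⟩
    rwa [A.mem_graph_snd_inj (mem_graph _ _) (hGgr x) rfl] at h
  rw [hAG, ← hQ G hpos]
  ext x
  exact A.mem_graph_snd_inj (hGgr (f x)) (hff x) rfl

section PartialIsometry

variable {B : K →L[𝕜] H} {Q : H →L[𝕜] H} {U : H →L[𝕜] K}

theorem adjoint_comp_partialIsometry_eq (hQ : Q.IsPositive) (hQQ : Q * Q = B ∘L B.adjoint)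
    (hUQ : U ∘L Q = B.adjoint) (hU : U.kerᗮ = Q.range.topologicalClosure) : B ∘L U = Q := by
  refine ContinuousLinearMap.eq_of_eqOn_of_eqOn_orthogonal U.kerᗮ (fun x hx => ?_) fun x hx => ?_
  · rw [hU] at hx
    refine Set.EqOn.closure (s := (Q.range : Set H)) ?_ (B ∘L U).continuous Q.continuous hx
    rintro _ ⟨y, rfl⟩
    change B ((U ∘L Q) y) = (Q * Q) y
    rw [hUQ, hQQ]
    rfl
  · have hx' := hx
    rw [Submodule.orthogonal_orthogonal] at hx'
    rw [hU, Submodule.orthogonal_closure, Q.orthogonal_range, hQ.isSelfAdjoint.adjoint_eq] at hx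
    change B (U x) = Q x
    rw [show U x = 0 from hx', show Q x = 0 from hx, _root_.map_zero]

theorem generalizedInverse_eq_compPMap (hQ : Q.IsPositive) (hQQ : Q * Q = B ∘L B.adjoint)
    (hUQ : U ∘L Q = B.adjoint) (hU : U.kerᗮ = Q.range.topologicalClosure)
    (hUr : U.range = B.adjoint.range.topologicalClosure) :
    generalizedInverse B = (U : H →ₗ[𝕜] K).compPMap (generalizedInverse Q) := by
  have hQa := hQ.isSelfAdjoint.adjoint_eq
  have hBU := adjoint_comp_partialIsometry_eq hQ hQQ hUQ hU
  have hB : Q ∘L U.adjoint = B := by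
    rw [← B.adjoint_adjoint, ← hUQ, ContinuousLinearMap.adjoint_comp, hQa]
  have hQker : Q.kerᗮ = Q.range.topologicalClosure := by rw [Q.orthogonal_ker, hQa]
  have hker : ∀ x, Q x = 0 → B.adjoint x = 0 := fun x hx => by
    rw [← hUQ, ContinuousLinearMap.comp_apply, hx, _root_.map_zero]
  have hker' : ∀ x, B.adjoint x = 0 → Q x = 0 := fun x hx => by
    have h : (Q * Q) x = 0 := by
      rw [hQQ, ContinuousLinearMap.comp_apply, hx, _root_.map_zero]
    have := ContinuousLinearMap.apply_eq_zero_of_adjoint_apply_eq_zero (B := Q) (y := x)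
    rw [hQa] at this
    exact this h
  refine ext_graph fun x y => ?_
  rw [mem_compPMap_graph_iff]
  simp only [mem_generalizedInverse_graph_iff, hQa]
  constructor
  · rintro ⟨h1, h2⟩
    -- B U U* = Q U* = B puts U U* U z - U z in N(B), while R(U) = N(B)ᗮ; this makes U* y the
    -- witness for T = U Q†.
    have hUy : U (U.adjoint y) = y := by
      have hy : y ∈ U.range := by rwa [hUr, ← B.orthogonal_ker]
      obtain ⟨z, rfl⟩ := hy
      rw [← sub_eq_zero]
      have h3 : U (U.adjoint (U z)) - U z ∈ B.ker := by
        change B (U (U.adjoint (U z)) - U z) = 0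
        have h4 : B (U (U.adjoint (U z))) = B (U z) := by
          calc B (U (U.adjoint (U z))) = (B ∘L U) (U.adjoint (U z)) := rfl
            _ = (Q ∘L U.adjoint) (U z) := by rw [hBU]; rfl
            _ = B (U z) := by rw [hB]
        rw [_root_.map_sub, h4, sub_self]
      have h5 : U (U.adjoint (U z)) - U z ∈ B.kerᗮ := by
        rw [B.orthogonal_ker, ← hUr]
        exact sub_mem ⟨_, rfl⟩ ⟨_, rfl⟩
      exact inner_self_eq_zero.1 ((Submodule.mem_orthogonal _ _).1 h5 _ h3)
    refine ⟨U.adjoint y, ⟨?_, ?_⟩, hUy⟩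
    · rw [← hB] at h1
      exact hker' _ (by rwa [← hB])
    · rw [hQker, ← hU]
      exact U.adjoint_apply_mem_ker_orthogonal y
  · rintro ⟨m, ⟨h1, h2⟩, rfl⟩
    refine ⟨?_, ?_⟩
    · change B.adjoint (x - (B ∘L U) m) = 0
      rw [hBU]
      exact hker _ h1
    · rw [B.orthogonal_ker, ← hUr]
      exact ⟨m, rfl⟩

theorem isPolarDecomposition_generalizedInverse (hQ : Q.IsPositive)
    (hQQ : Q * Q = B ∘L B.adjoint) (hUQ : U ∘L Q = B.adjoint)
    (hU : U.kerᗮ = Q.range.topologicalClosure)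
    (hUr : U.range = B.adjoint.range.topologicalClosure) (hUn : ∀ x ∈ U.kerᗮ, ‖U x‖ = ‖x‖) :
    (generalizedInverse B).IsPolarDecomposition U (generalizedInverse Q) where
  isModulus := isModulus_generalizedInverse hQ hQQ
  isometric := hUn
  initial := by
    rw [rangeSpace_generalizedInverse, Q.orthogonal_ker, hQ.isSelfAdjoint.adjoint_eq]
    exact hU.trans (Submodule.isClosed_topologicalClosure _).submodule_topologicalClosure_eq.symm
  final := by
    rw [rangeSpace_generalizedInverse, B.orthogonal_ker]
    exact hUr.trans (Submodule.isClosed_topologicalClosure _).submodule_topologicalClosure_eq.symm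
  eq_comp := generalizedInverse_eq_compPMap hQ hQQ hUQ hU hUr

end PartialIsometry

theorem rangeSpace_toPMap_top {R E F : Type*} [Ring R] [AddCommGroup E] [Module R E]
    [AddCommGroup F] [Module R F] (f : E →ₗ[R] F) : (f.toPMap ⊤).rangeSpace = LinearMap.range f := by
  ext y
  rw [mem_rangeSpace_iff]
  simp

theorem isPolarDecomposition_toPMap_top {W : H →L[𝕜] K} {Q : H →L[𝕜] H} {U : H →L[𝕜] K}
    (hQ : Q.IsPositive) (hQQ : Q * Q = W.adjoint ∘L W) (hUQ : U ∘L Q = W)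
    (hU : U.kerᗮ = Q.range.topologicalClosure)
    (hUr : U.range = W.range.topologicalClosure) (hUn : ∀ x ∈ U.kerᗮ, ‖U x‖ = ‖x‖) :
    ((W : H →ₗ[𝕜] K).toPMap ⊤).IsPolarDecomposition U ((Q : H →ₗ[𝕜] H).toPMap ⊤) where
  isModulus := isModulus_toPMap_top hQ hQQ
  isometric := hUn
  initial := by rw [rangeSpace_toPMap_top]; exact hU
  final := by rw [rangeSpace_toPMap_top]; exact hUr
  eq_comp := by
    rw [← hUQ]
    rfl

omit [CompleteSpace H] [CompleteSpace K] in
/-- The restriction of a bounded operator to a dense subspace is closable, and its closure is the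
operator itself. -/
theorem isClosable_toPMap_and_closure_eq (U : H →L[𝕜] K) {D : Submodule 𝕜 H}
    (hD : Dense (D : Set H)) : ((U : H →ₗ[𝕜] K).toPMap D).IsClosable ∧
      ((U : H →ₗ[𝕜] K).toPMap D).closure = (U : H →ₗ[𝕜] K).toPMap ⊤ := by
  have hle : (U : H →ₗ[𝕜] K).toPMap D ≤ (U : H →ₗ[𝕜] K).toPMap ⊤ :=
    ⟨le_top, fun x y h => by
      change U x = U y
      rw [h]⟩
  have hcl : ((U : H →ₗ[𝕜] K).toPMap ⊤).IsClosed := by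
    have : (((U : H →ₗ[𝕜] K).toPMap ⊤).graph : Set (H × K)) = {p | U p.1 = p.2} := by
      ext ⟨x, y⟩
      exact mem_toPMap_graph_iff.trans ⟨fun h => h.2, fun h => ⟨trivial, h⟩⟩
    change _root_.IsClosed (((U : H →ₗ[𝕜] K).toPMap ⊤).graph : Set (H × K))
    rw [this]
    exact isClosed_eq (by fun_prop) (by fun_prop)
  have hcb := hcl.isClosable.leIsClosable hle
  refine ⟨hcb, LinearPMap.eq_toPMap_top fun x => ?_⟩
  rw [← hcb.graph_closure_eq_closure_graph]
  change (x, U x) ∈ _root_.closure (((U : H →ₗ[𝕜] K).toPMap D).graph : Set (H × K))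
  have hc : Continuous fun z : H => (z, U z) := by fun_prop
  refine closure_mono ?_ (image_closure_subset_closure_image hc ⟨x, hD x, rfl⟩)
  rintro _ ⟨z, hz, rfl⟩
  exact mem_toPMap_graph_iff.2 ⟨hz, rfl⟩

theorem product_toPMap_top {R E F G : Type*} [Ring R] [AddCommGroup E] [Module R E]
    [AddCommGroup F] [Module R F] [AddCommGroup G] [Module R G] (f : F →ₗ[R] G)
    (A : E →ₗ.[R] F) : (f.toPMap ⊤).product A = f.compPMap A := by
  refine ext_graph fun x z => ?_
  simp only [mem_product_graph_iff, mem_toPMap_graph_iff, mem_compPMap_graph_iff,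
    Submodule.mem_top, true_and]

omit [CompleteSpace K] in
/-- If `U Q = W` with `Q` symmetric and `N(Q) ⊆ N(U)`, then `W Q† = U` on the domain of `Q†`. -/
theorem compPMap_generalizedInverse_eq_toPMap {W : H →L[𝕜] K} {Q : H →L[𝕜] H} {U : H →L[𝕜] K}
    (hQ : Q.IsPositive) (hUQ : U ∘L Q = W) (hU : U.kerᗮ = Q.range.topologicalClosure) :
    (W : H →ₗ[𝕜] K).compPMap (generalizedInverse Q) =
      (U : H →ₗ[𝕜] K).toPMap (generalizedInverse Q).domain := by
  have hker : U.ker = Q.ker := by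
    rw [← U.ker.orthogonal_orthogonal, hU, Submodule.orthogonal_closure, Q.orthogonal_range,
      hQ.isSelfAdjoint.adjoint_eq]
  have key : ∀ x y, (x, y) ∈ (generalizedInverse Q).graph → W y = U x := fun x y h => by
    have h1 := (mem_generalizedInverse_graph_iff.1 h).1
    rw [hQ.isSelfAdjoint.adjoint_eq] at h1
    have h2 : x - Q y ∈ U.ker := by rw [hker]; exact h1
    have h3 : U (x - Q y) = 0 := h2
    rw [_root_.map_sub, sub_eq_zero] at h3
    rw [h3, ← hUQ]
    rfl
  refine ext_graph fun x z => ?_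
  rw [mem_compPMap_graph_iff, mem_toPMap_graph_iff, mem_domain_iff]
  constructor
  · rintro ⟨y, hy, rfl⟩
    exact ⟨⟨y, hy⟩, (key x y hy).symm⟩
  · rintro ⟨⟨y, hy⟩, rfl⟩
    exact ⟨y, hy, key x y hy⟩

end LinearPMap
end

theorem theorem2p10 {𝕜 H K : Type*} [RCLike 𝕜]
    [NormedAddCommGroup H] [InnerProductSpace 𝕜 H] [CompleteSpace H]
    [NormedAddCommGroup K] [InnerProductSpace 𝕜 K] [CompleteSpace K]
    (T : H →ₗ.[𝕜] K) (hclosed : T.IsClosed) (hdense : Dense (T.domain : Set H))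
    (hrange : IsClosed (T.rangeSpace : Set K)) :
    -- `T = U_T |T|` is the polar decomposition of `T`
    (T.IsPolarDecomposition T.polarIsometry T.modulus ∧
      ∀ (U : H →L[𝕜] K) (A : H →ₗ.[𝕜] H), T.IsPolarDecomposition U A →
        U = T.polarIsometry ∧ A = T.modulus) ∧
    -- `w(T) |T|` is closable, and `U_T` is its closure
    (T.cauchyDual.product T.modulus).IsClosable ∧
    (T.cauchyDual.product T.modulus).closure = (T.polarIsometry : H →ₗ[𝕜] K).toPMap ⊤ ∧
    -- `w(T) = U_T |w(T)|` is the polar decomposition of `w(T)`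
    (T.cauchyDual.IsPolarDecomposition T.polarIsometry T.cauchyDual.modulus ∧
      ∀ (U : H →L[𝕜] K) (A : H →ₗ.[𝕜] H), T.cauchyDual.IsPolarDecomposition U A →
        U = T.polarIsometry ∧ A = T.cauchyDual.modulus) ∧
    T.cauchyDual.polarIsometry = T.polarIsometry := by
  obtain ⟨B, rfl⟩ := LinearPMap.exists_eq_generalizedInverse hclosed hdense hrange
  obtain ⟨Q, hQ, hQQ, huniq⟩ := B.adjoint.exists_unique_isPositive_mul_self_eq
  obtain ⟨U, hUQ, hU, hUr, hUn⟩ := ContinuousLinearMap.exists_partialIsometry_comp_eq hQ hQQ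
  have hW := LinearPMap.isPolarDecomposition_toPMap_top hQ hQQ hUQ hU hUr hUn
  have hWu := fun A => LinearPMap.IsModulus.eq_toPMap_top (A := A) huniq
  -- Q was taken as the root for W = B*. Reading W* W as B B* lets the same Q and U serve T = B†.
  rw [ContinuousLinearMap.adjoint_adjoint] at hQQ huniq
  have hT := LinearPMap.isPolarDecomposition_generalizedInverse hQ hQQ hUQ hU hUr hUn
  have hTu := fun A => LinearPMap.IsModulus.eq_generalizedInverse (A := A) huniq
  have hTm := hT.modulus_eq hTu
  have hTp := hT.polarIsometry_eq hTu
  have hWp := hW.polarIsometry_eq hWu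
  have hcl := LinearPMap.isClosable_toPMap_and_closure_eq U
    (LinearPMap.dense_domain_generalizedInverse Q)
  have hprod : (LinearPMap.generalizedInverse B).cauchyDual.product
      (LinearPMap.generalizedInverse B).modulus =
        (U : H →ₗ[𝕜] K).toPMap (LinearPMap.generalizedInverse Q).domain := by
    rw [LinearPMap.cauchyDual_generalizedInverse, hTm, LinearPMap.product_toPMap_top,
      LinearPMap.compPMap_generalizedInverse_eq_toPMap hQ hUQ hU]
  refine ⟨hT.isPolarDecomposition_polarIsometry_modulus hTu, ?_, ?_, ?_, ?_⟩
  · rw [hprod]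
    exact hcl.1
  · rw [hprod, hTp]
    exact hcl.2
  · rw [LinearPMap.cauchyDual_generalizedInverse, hTp, ← hWp]
    exact hW.isPolarDecomposition_polarIsometry_modulus hWu
  · rw [LinearPMap.cauchyDual_generalizedInverse, hTp, hWp]
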